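/- Let $(G,+)$ be a countable abelian group, regarded as a discrete group, and let $(T_g)_{g\in G}$ be a measure preserving action of $G$ on a separable probability space $(X,\mathcal A,\mu)$. Let $\ell\ge 1$ and let $\phi_1,\dots,\phi_\ell:G\to G$ be homomorphisms such that $\ker\phi_j$ is finite for every $j$ and $\ker(\phi_j-\phi_i)$ is finite for all $i\ne j$. Notation. The action is strongly mixing if $\lim_{g\to\infty}\mu(A_0\cap T_gA_1)=\mu(A_0)\mu(A_1)$ for all $A_0,A_1\in\mathcal A$, where $g\to\infty$ means that $g$ leaves every finite subset of $G$. A sequence $(\mathbf g_k)_{k\in\mathbb N}=(g_{k,1},\dots,g_{k,\ell})_{k\in\mathbb N}$ in $G^\ell$ is non-degenerated if $\lim_{k\to\infty}g_{k,j}=\infty$ for every $j$. For $S\subseteq\mathbb N$ let $S^{(\ell)}$ be the family of $\ell$-element subsets of $S$, and for $\alpha=\{k_1<\dots<k_\ell\}\in\mathbb N^{(\ell)}$ put $g_\alpha=g_{k_1,1}+\dots+g_{k_\ell,\ell}$. For an infinite $S\subseteq\mathbb N$ and real numbers $x_\alpha$ ($\alpha\in\mathbb N^{(\ell)}$) and $x$,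 write $\mathcal R\text{-}\lim_{\alpha\in S^{(\ell)}}x_\alpha=x$ if for every $\epsilon>0$ there is $\alpha_0\in\mathbb N^{(\ell)}$ such that $|x_\alpha-x|<\epsilon$ for all $\alpha\in S^{(\ell)}$ with $\min\alpha>\max\alpha_0$. A set $D\subseteq G$ is a $\Sigma_\ell$ set if $D=\{g_\alpha:\alpha\in\mathbb N^{(\ell)}\}$ for some non-degenerated sequence in $G^\ell$, and $E\subseteq G$ is $\Sigma_\ell^*$ if it meets every $\Sigma_\ell$ set. Consider the following two statements. (a) For every non-degenerated sequence $(\mathbf g_k)_{k\in\mathbb N}$ in $G^\ell$ there is an infinite set $S\subseteq\mathbb N$ such that for all $A_0,\dots,A_\ell\in\mathcal A$, $$\mathcal R\text{-}\lim_{\alpha\in S^{(\ell)}}\mu\bigl(A_0\cap T_{\phi_1(g_\alpha)}A_1\cap\dots\cap T_{\phi_\ell(g_\alpha)}A_\ell\bigr)=\prod_{j=0}^\ell\mu(A_j).$$ (b) For all $A_0,\dots,A_\ell\in\mathcal A$ and every $\epsilon>0$ the set $$R_\epsilon^{\phi_1,\dots,\phi_\ell}(A_0,\dots,A_\ell)=\Bigl\{g\in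 G:\Bigl|\mu\bigl(A_0\cap T_{\phi_1(g)}A_1\cap\dots\cap T_{\phi_\ell(g)}A_\ell\bigr)-\prod_{j=0}^\ell\mu(A_j)\Bigr|<\epsilon\Bigr\}$$ is $\Sigma_\ell^*$. If the action is strongly mixing, then (a) and (b) hold. Moreover (a) and (b) are equivalent, whether or not the action is strongly mixing. -/

import Mathlib

open Filter Topology MeasureTheory
open scoped Pointwise

namespace StrongMixing

/-- The family of all `m`-element subsets of `ℕ`. -/
abbrev NSubsets (m : ℕ) : Type := {α : Finset ℕ // α.card = m}

/-- `IsRLim S x a`: the `R`-limit of `x α`, for `α` running through the `m`-element subsets of `S`,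
is `a`. The condition on `α₀` and `α` says that `max α₀ < min α`. -/
def IsRLim {E : Type*} [PseudoMetricSpace E] {m : ℕ} (S : Set ℕ) (x : NSubsets m → E) (a : E) :
    Prop :=
  ∀ ε : ℝ, 0 < ε → ∃ α₀ : NSubsets m, ∀ α : NSubsets m, (α.1 : Set ℕ) ⊆ S →
    (∀ i ∈ α₀.1, ∀ k ∈ α.1, i < k) → dist (x α) a < ε

/-- A sequence in `G ^ m` is non-degenerated if each of its coordinates tends to infinity in the
discrete group `G`, that is, eventually leaves every finite set. -/
def NonDegenerated {G : Type*} {m : ℕ} (g : ℕ → Fin m → G) : Prop :=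
  ∀ j : Fin m, Tendsto (fun k => g k j) atTop cofinite

/-- For `α = {k₁ < ⋯ < kₘ}`, the element `g_{k₁,1} + ⋯ + g_{kₘ,m}` of `G`. -/
def alphaSum {G : Type*} [AddCommGroup G] {m : ℕ} (g : ℕ → Fin m → G) (α : NSubsets m) : G :=
  ∑ j : Fin m, g (α.1.orderEmbOfFin α.2 j) j

/-- `Σ_m` sets: the sets `{g_{k₁,1} + ⋯ + g_{kₘ,m} | k₁ < ⋯ < kₘ}`, where each of the `m` sequences
`k ↦ g_{k,j}` tends to infinity. -/
def IsSigma {G : Type*} [AddCommGroup G] (m : ℕ) (D : Set G) : Prop :=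
  ∃ g : ℕ → Fin m → G, NonDegenerated g ∧ D = Set.range (alphaSum g)

/-- `Σ_m^*` sets: the sets that meet every `Σ_m` set. -/
def IsSigmaStar {G : Type*} [AddCommGroup G] (m : ℕ) (E : Set G) : Prop :=
  ∀ D : Set G, IsSigma m D → (E ∩ D).Nonempty

/-- Strong mixing of an action of a discrete group; `g +ᵥ A` is the image `T_g A` of the set `A`
under the action of `g`. -/
def IsStronglyMixing (G : Type*) {X : Type*} [AddCommGroup G] [AddAction G X] [MeasurableSpace X]
    (μ : Measure X) : Prop :=
  ∀ A₀ A₁ : Set X, MeasurableSet A₀ → MeasurableSet A₁ →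
    Tendsto (fun g : G => μ.real (A₀ ∩ (g +ᵥ A₁))) cofinite (𝓝 (μ.real A₀ * μ.real A₁))

/-- The multicorrelation `μ (A₀ ∩ T_{φ₁(g)} A₁ ∩ ⋯ ∩ T_{φ_ℓ(g)} A_ℓ)`. -/
noncomputable def correlation {G X : Type*} [AddCommGroup G] [AddAction G X] [MeasurableSpace X]
    (μ : Measure X) {ℓ : ℕ} (φ : Fin ℓ → G →+ G) (A : Fin (ℓ + 1) → Set X) (g : G) : ℝ :=
  μ.real (A 0 ∩ ⋂ j : Fin ℓ, (φ j g +ᵥ A j.succ))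

/-- The set `R_ε^{φ₁,…,φ_ℓ}(A₀,…,A_ℓ)`. -/
def returnSet {G X : Type*} [AddCommGroup G] [AddAction G X] [MeasurableSpace X]
    (μ : Measure X) {ℓ : ℕ} (φ : Fin ℓ → G →+ G) (A : Fin (ℓ + 1) → Set X) (ε : ℝ) : Set G :=
  {g : G | |correlation μ φ A g - ∏ j : Fin (ℓ + 1), μ.real (A j)| < ε}

/-- Along every non-degenerated sequence in `G ^ ℓ` there is an infinite set `S`, the same for all
measurable sets `A₀, …, A_ℓ`, along which the `R`-limits of the multicorrelations are the products
of the measures. -/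
def HasDiagonalRLimits {G X : Type*} [AddCommGroup G] [AddAction G X] [MeasurableSpace X]
    (μ : Measure X) {ℓ : ℕ} (φ : Fin ℓ → G →+ G) : Prop :=
  ∀ g : ℕ → Fin ℓ → G, NonDegenerated g →
    ∃ S : Set ℕ, S.Infinite ∧
      ∀ A : Fin (ℓ + 1) → Set X, (∀ j, MeasurableSet (A j)) →
        IsRLim S (fun α : NSubsets ℓ => correlation μ φ A (alphaSum g α))
          (∏ j : Fin (ℓ + 1), μ.real (A j))

/-- All sets `R_ε^{φ₁,…,φ_ℓ}(A₀,…,A_ℓ)` are `Σ_ℓ^*`. -/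
def HasDiagonalSigmaStar {G X : Type*} [AddCommGroup G] [AddAction G X] [MeasurableSpace X]
    (μ : Measure X) {ℓ : ℕ} (φ : Fin ℓ → G →+ G) : Prop :=
  ∀ A : Fin (ℓ + 1) → Set X, (∀ j, MeasurableSet (A j)) →
    ∀ ε : ℝ, 0 < ε → IsSigmaStar ℓ (returnSet μ φ A ε)

end StrongMixing

/-!
Strong mixing implies `HasDiagonalSigmaStar` by a successive passage to limits. Put `φ₀ = 0`, so
that the correlation is `μ (⋂ j, T_{φ_j(g)} A_j)`, and consider functions `Λ` of tuples `(A₀, …,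
A_ℓ)` of measurable sets that behave like joinings of `ℓ + 1` copies of `X`: they are invariant
under the diagonal action and satisfy the Cauchy-Schwarz inequality (`IsCorrelationForm`). Start
from `Λ A = μ (⋂ j, A_j)`, for which any single coordinate is trivially independent, and pass to
the limit along an ultrafilter in `Λ (T_{φ_0(g_k)} A_0, …, T_{φ_ℓ(g_k)} A_ℓ)`, where `g_k → ∞`. If
any `n` coordinates are independent for `Λ`, then any `n + 1` are independent for the limit
(`tendsto_twist_of_isIndepForm`): by diagonal invariance one of them may be left fixed, and the
others are then translated by `(φ_j - φ_i)(g_k) → ∞`; as these others are independent, strong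
mixing makes their translates, once centred, asymptotically orthogonal, hence weakly null
(`tendsto_zero_of_sq_sum_le`). Taking the limit along the `ℓ` coordinates of a non-degenerated
sequence, all `ℓ + 1` sets become independent: the iterated limit of the correlations at `g_{k₁,1}
+ ⋯ + g_{k_ℓ,ℓ}` is the product of the measures, so some correlation with `k₁ < ⋯ < k_ℓ` is close
to it.

The equivalence of `HasDiagonalRLimits` and `HasDiagonalSigmaStar` does not use mixing. To obtain
the former from the latter, Ramsey's theorem (`exists_infinite_homogeneous`) shows that any
infinite set of indices contains an infinite subset on which all correlations, for given sets `A_j`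
and a given tolerance, are close to the product: the opposite colour is excluded because a
subsequence of a non-degenerated sequence is again non-degenerated. A diagonal argument over a
countable measure-dense family of sets finishes the proof, since correlations are Lipschitz in the
sets `A_j`.
-/

namespace StrongMixing

/-! ### Ramsey's theorem and diagonalization -/

/-- `IteratedEventually U P i F` says that `P (F ∪ {k₁, …, kᵢ})` holds for `U`-almost all `k₁`, then
`U`-almost all `k₂`, and so on up to `kᵢ`. -/
def IteratedEventually (U : Ultrafilter ℕ) (P : Finset ℕ → Prop) : ℕ → Finset ℕ → Prop
  | 0, F => P F
  | i + 1, F => ∀ᶠ k in (U : Filter ℕ), IteratedEventually U P i (insert k F)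

lemma iteratedEventually_not (U : Ultrafilter ℕ) (P : Finset ℕ → Prop) (i : ℕ) (F : Finset ℕ) :
    IteratedEventually U (fun F => ¬ P F) i F ↔ ¬ IteratedEventually U P i F := by
  induction i generalizing F with
  | zero => rfl
  | succ i ih => simp only [IteratedEventually, ih, Ultrafilter.eventually_not]

/-- A maximal set all of whose small finite subsets satisfy the appropriate iterated quantifier is
infinite, since a finite one could be enlarged. -/
lemma exists_infinite_of_iteratedEventually {U : Ultrafilter ℕ} (hU : (U : Filter ℕ) ≤ cofinite)
    {T : Set ℕ} (hT : T ∈ U) {P : Finset ℕ → Prop} {m : ℕ} (h : IteratedEventually U P m ∅) :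
    ∃ S ⊆ T, S.Infinite ∧ ∀ α : Finset ℕ, (α : Set ℕ) ⊆ S → α.card = m → P α := by
  let good : Set (Set ℕ) := {S | S ⊆ T ∧ ∀ β : Finset ℕ, (β : Set ℕ) ⊆ S → β.card ≤ m →
    IteratedEventually U P (m - β.card) β}
  have hchar : Order.IsOfFiniteCharacter good := by
    intro S
    constructor
    · rintro ⟨h1, h2⟩ S' hS' -
      exact ⟨hS'.trans h1, fun β hβ => h2 β (hβ.trans hS')⟩
    · intro hS
      refine ⟨fun x hx => ?_, fun β hβ => (hS β hβ β.finite_toSet).2 β le_rfl⟩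
      exact (hS {x} (by simpa using hx) (Set.finite_singleton x)).1 rfl
  have hempty : (∅ : Set ℕ) ∈ good := by
    refine ⟨Set.empty_subset T, fun β hβ _ => ?_⟩
    have : β = ∅ := by simpa using hβ
    subst this
    simpa using h
  obtain ⟨S, -, hS⟩ := hchar.exists_maximal hempty
  refine ⟨S, hS.prop.1, fun hfin => ?_, fun α hα hcard => ?_⟩
  · have key : ∀ᶠ k in (U : Filter ℕ), ∀ β ∈ hfin.toFinset.powerset, β.card < m →
        IteratedEventually U P (m - β.card - 1) (insert k β) := by
      rw [Filter.eventually_all_finset]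
      intro β hβ
      by_cases hlt : β.card < m
      · have hβ' := hS.prop.2 β (by simpa [Finset.subset_iff, Set.subset_def] using hβ) hlt.le
        obtain ⟨i, hi⟩ : ∃ i, m - β.card = i + 1 := ⟨m - β.card - 1, by omega⟩
        rw [hi] at hβ' ⊢
        exact hβ'.mono fun k hk _ => hk
      · simp [hlt]
    obtain ⟨k, hk, hkT, hkS⟩ :=
      (key.and ((show ∀ᶠ k in (U : Filter ℕ), k ∈ T from hT).and
        (hU hfin.compl_mem_cofinite))).exists
    have hins : insert k S ∈ good := by
      refine ⟨Set.insert_subset hkT hS.prop.1, fun β hβ hcard => ?_⟩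
      by_cases hkβ : k ∈ β
      · have hsub : ((β.erase k : Finset ℕ) : Set ℕ) ⊆ S := by
          intro x hx
          rw [Finset.coe_erase] at hx
          exact (hβ hx.1).resolve_left hx.2
        have hc := Finset.card_erase_add_one hkβ
        have := hk (β.erase k) (Finset.mem_powerset.2 fun x hx => hfin.mem_toFinset.2 (hsub hx))
          (by omega)
        rw [Finset.insert_erase hkβ] at this
        convert! this using 1
        omega
      · refine hS.prop.2 β (fun x hx => (hβ hx).resolve_left ?_) hcard
        rintro rfl
        exact hkβ hx
    exact hkS (hS.le_of_ge hins (Set.subset_insert k S) (Set.mem_insert k S))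
  · simpa [hcard, IteratedEventually] using hS.prop.2 α hα hcard.le

/-- The infinite Ramsey theorem for colourings of the `m`-element subsets of `ℕ` by two colours. -/
theorem exists_infinite_homogeneous (m : ℕ) (P : Finset ℕ → Prop) {T : Set ℕ} (hT : T.Infinite) :
    ∃ S ⊆ T, S.Infinite ∧
      ((∀ α : Finset ℕ, (α : Set ℕ) ⊆ S → α.card = m → P α) ∨
        (∀ α : Finset ℕ, (α : Set ℕ) ⊆ S → α.card = m → ¬ P α)) := by
  have := hT.cofinite_inf_principal_neBot
  let U := Ultrafilter.of (cofinite ⊓ 𝓟 T)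
  have hU : (U : Filter ℕ) ≤ cofinite := (Ultrafilter.of_le _).trans inf_le_left
  have hTU : T ∈ U := le_principal_iff.1 ((Ultrafilter.of_le _).trans inf_le_right)
  by_cases h : IteratedEventually U P m ∅
  · obtain ⟨S, hST, hS, hP⟩ := exists_infinite_of_iteratedEventually hU hTU h
    exact ⟨S, hST, hS, .inl hP⟩
  · rw [← iteratedEventually_not] at h
    obtain ⟨S, hST, hS, hP⟩ := exists_infinite_of_iteratedEventually hU hTU h
    exact ⟨S, hST, hS, .inr hP⟩

/-- A diagonal argument: if every infinite set can be thinned out so as to have the `n`-th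
property, then some infinite `S` is, for each `n`, contained in a set with the `n`-th property up to
finitely many elements. -/
lemma exists_infinite_diagonal {R : ℕ → Set ℕ → Prop}
    (h : ∀ n, ∀ T : Set ℕ, T.Infinite → ∃ T' ⊆ T, T'.Infinite ∧ R n T') :
    ∃ S : Set ℕ, S.Infinite ∧ ∀ n, ∃ N, ∃ T, R n T ∧ S ∩ Set.Ioi N ⊆ T := by
  choose f hsub hinf hR using h
  let s : ℕ → {T : Set ℕ // T.Infinite} :=
    Nat.rec ⟨Set.univ, Set.infinite_univ⟩ fun n T => ⟨f n T.1 T.2, hinf n T.1 T.2⟩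
  have hanti : Antitone fun n => (s n).1 := antitone_nat_of_succ_le fun n => hsub n _ (s n).2
  obtain ⟨e, he, hmem⟩ := extraction_forall_of_frequently
    (P := fun n k => k ∈ (s n).1) fun n => Nat.frequently_atTop_iff_infinite.2 (s n).2
  refine ⟨Set.range e, Set.infinite_range_of_injective he.injective, fun n =>
    ⟨e n, (s (n + 1)).1, hR n _ (s n).2, ?_⟩⟩
  rintro _ ⟨⟨i, rfl⟩, hi⟩
  exact hanti (Nat.succ_le_of_lt (he.lt_iff_lt.1 hi)) (hmem i)

/-! ### Almost orthogonal families -/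

/-- A form of Bessel's inequality: think of `a i = ⟪f, v i⟫` with `‖f‖ ≤ 1` and
`c i j = ⟪v i, v j⟫`. A bounded family `v` which is asymptotically orthogonal converges weakly
to `0`. -/
lemma tendsto_zero_of_sq_sum_le {ι : Type*} {a : ι → ℝ} {c : ι → ι → ℝ} {C : ℝ}
    (h : ∀ K : Finset ι, (∑ i ∈ K, a i) ^ 2 ≤ ∑ i ∈ K, ∑ j ∈ K, c i j)
    (hsymm : ∀ i j, c i j = c j i) (hdiag : ∀ i, c i i ≤ C)
    (hlim : ∀ j, Tendsto (fun i => c i j) cofinite (𝓝 0)) :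
    Tendsto a cofinite (𝓝 0) := by
  classical
  -- If `σ * a` is at least `δ` infinitely often, a greedy choice of `N` such indices makes the sum
  -- of the `a i` of size `N * δ`, while its square is of size `N`.
  -- The sign `σ` treats upper and lower bounds together.
  have key : ∀ σ : ℝ, σ ^ 2 = 1 → ∀ δ : ℝ, 0 < δ → ∀ᶠ i in cofinite, σ * a i < δ := by
    intro σ hσ δ hδ
    by_contra hcon
    have hfreq : ∃ᶠ i in cofinite, δ ≤ σ * a i := by simpa [Filter.Frequently] using hcon
    have greedy : ∀ N : ℕ, ∃ K : Finset ι, N * δ ≤ σ * ∑ i ∈ K, a i ∧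
        ∑ i ∈ K, ∑ j ∈ K, c i j ≤ N * (C + 2) := by
      intro N
      induction N with
      | zero => exact ⟨∅, by simp⟩
      | succ N ih =>
        obtain ⟨K, hK1, hK2⟩ := ih
        have hsum : Tendsto (fun i => ∑ j ∈ K, c i j) cofinite (𝓝 0) := by
          simpa using tendsto_finsetSum K fun j _ => hlim j
        obtain ⟨i, hi, hiK, hic⟩ := (hfreq.and_eventually
          ((show ∀ᶠ i in cofinite, i ∉ K from K.finite_toSet.compl_mem_cofinite).and
            (hsum.eventually_lt_const one_pos))).exists
        refine ⟨insert i K, ?_, ?_⟩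
        · rw [Finset.sum_insert hiK]
          push_cast
          linarith
        · have : ∑ j ∈ K, c j i = ∑ j ∈ K, c i j := Finset.sum_congr rfl fun j _ => hsymm j i
          rw [Finset.sum_insert hiK, Finset.sum_insert hiK]
          simp_rw [Finset.sum_insert hiK, Finset.sum_add_distrib]
          rw [this]
          push_cast
          linarith [hdiag i]
    obtain ⟨N, hN⟩ := exists_nat_gt (max 1 ((C + 2) / δ ^ 2))
    have hN1 : (1 : ℝ) < N := (le_max_left _ _).trans_lt hN
    have hN2 : C + 2 < N * δ ^ 2 := by
      rw [← div_lt_iff₀ (by positivity)]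
      exact (le_max_right _ _).trans_lt hN
    obtain ⟨K, hK1, hK2⟩ := greedy N
    have h1 : (N * δ) ^ 2 ≤ (σ * ∑ i ∈ K, a i) ^ 2 := by gcongr
    rw [mul_pow σ, hσ, one_mul] at h1
    have h2 := h1.trans ((h K).trans hK2)
    nlinarith
  rw [Metric.tendsto_nhds]
  intro δ hδ
  filter_upwards [key 1 (by norm_num) δ hδ, key (-1) (by norm_num) δ hδ] with i h1 h2
  rw [Real.dist_eq, sub_zero, abs_lt]
  constructor <;> linarith

/-! ### Correlation forms -/

variable {G X ι : Type*} [AddCommGroup G] [AddAction G X] [MeasurableSpace X]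

/-- The properties of `A ↦ μ (⋂ j, A j)`, as a function of a tuple of sets, that survive twisting by
the action and passing to limits: it takes values in `[0, 1]`, it is invariant under the diagonal
action, and it satisfies the Cauchy-Schwarz inequality `(∫ 1_B F) ^ 2 ≤ ∫ F ^ 2` for
`F = ∑ k ∈ K, 1_{A k} - r`. Such forms play the role of joinings of `ι` copies of `X`; no measure on
a product space is involved, so no regularity of `X` is needed. -/
structure IsCorrelationForm (G : Type*) [AddCommGroup G] [AddAction G X]
    (Λ : (ι → Set X) → ℝ) : Prop where
  mem_Icc : ∀ A, (∀ j, MeasurableSet (A j)) → Λ A ∈ Set.Icc (0 : ℝ) 1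
  vadd_eq : ∀ A, (∀ j, MeasurableSet (A j)) → ∀ g : G, Λ (fun j => g +ᵥ A j) = Λ A
  sq_le : ∀ (K : Finset G) (A : G → ι → Set X) (B : ι → Set X) (r : ℝ),
    (∀ k j, MeasurableSet (A k j)) → (∀ j, MeasurableSet (B j)) →
    (∑ k ∈ K, Λ (fun j => B j ∩ A k j) - r * Λ B) ^ 2 ≤
      ∑ k ∈ K, ∑ l ∈ K, Λ (fun j => A k j ∩ A l j) - 2 * r * ∑ k ∈ K, Λ (A k) + r ^ 2

/-- Any `n` coordinates are independent with respect to the form `Λ`. The marginal on the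
coordinates in `J` is read off from the tuples that are the whole space outside `J`. -/
def IsIndepForm [Fintype ι] (μ : Measure X) (n : ℕ) (Λ : (ι → Set X) → ℝ) : Prop :=
  ∀ J : Finset ι, J.card ≤ n → ∀ A : ι → Set X, (∀ j, MeasurableSet (A j)) →
    (∀ j ∉ J, A j = Set.univ) → Λ A = ∏ j, μ.real (A j)

/-- The Cauchy-Schwarz inequality `(∫ 1_B F) ^ 2 ≤ ∫ F ^ 2` for `F = ∑ k ∈ K, 1_{A k} - r`. -/
lemma sq_sum_measureReal_inter_le {κ : Type*} (μ : Measure X) [IsProbabilityMeasure μ]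
    (K : Finset κ) {A : κ → Set X} {B : Set X} (r : ℝ) (hA : ∀ k, MeasurableSet (A k))
    (hB : MeasurableSet B) :
    (∑ k ∈ K, μ.real (B ∩ A k) - r * μ.real B) ^ 2 ≤
      ∑ k ∈ K, ∑ l ∈ K, μ.real (A k ∩ A l) - 2 * r * ∑ k ∈ K, μ.real (A k) + r ^ 2 := by
  let e : Set X → X → ℝ := fun s => s.indicator 1
  have hint : ∀ s, MeasurableSet s → Integrable (e s) μ := fun s hs =>
    (integrable_const (1 : ℝ)).indicator hs
  have hval : ∀ s, MeasurableSet s → ∫ x, e s x ∂μ = μ.real s := fun s hs =>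
    integral_indicator_one hs
  have hmul : ∀ s t x, e (s ∩ t) x = e s x * e t x := fun s t x => by
    simp [e, Set.inter_indicator_one]
  set c := ∑ k ∈ K, μ.real (B ∩ A k) - r * μ.real B with hc
  have hI1 : Integrable (fun x => ∑ k ∈ K, e (B ∩ A k) x - r * e B x) μ :=
    (integrable_finsetSum _ fun k _ => hint _ (hB.inter (hA k))).sub ((hint _ hB).const_mul r)
  have hI2 : Integrable (fun x => ∑ k ∈ K, ∑ l ∈ K, e (A k ∩ A l) x) μ :=
    integrable_finsetSum _ fun k _ => integrable_finsetSum _ fun l _ =>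
      hint _ ((hA k).inter (hA l))
  have hI3 : Integrable (fun x => ∑ k ∈ K, e (A k) x) μ :=
    integrable_finsetSum _ fun k _ => hint _ (hA k)
  have h1 : ∫ x, (2 * c * (∑ k ∈ K, e (B ∩ A k) x - r * e B x) - c ^ 2) ∂μ = c ^ 2 := by
    rw [integral_sub (hI1.const_mul _) (integrable_const _), integral_const_mul,
      integral_sub (integrable_finsetSum _ fun k _ => hint _ (hB.inter (hA k)))
        ((hint _ hB).const_mul r),
      integral_finsetSum _ fun k _ => hint _ (hB.inter (hA k)), integral_const_mul, hval _ hB,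
      Finset.sum_congr rfl fun k _ => hval _ (hB.inter (hA k)), ← hc]
    simp
    ring
  have h2 : ∫ x, (∑ k ∈ K, ∑ l ∈ K, e (A k ∩ A l) x - 2 * r * ∑ k ∈ K, e (A k) x + r ^ 2) ∂μ =
      ∑ k ∈ K, ∑ l ∈ K, μ.real (A k ∩ A l) - 2 * r * ∑ k ∈ K, μ.real (A k) + r ^ 2 := by
    rw [integral_add (f := fun x => ∑ k ∈ K, ∑ l ∈ K, e (A k ∩ A l) x - 2 * r * ∑ k ∈ K, e (A k) x)
        (hI2.sub (hI3.const_mul _)) (integrable_const _),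
      integral_sub hI2 (hI3.const_mul _), integral_const_mul,
      integral_finsetSum _ fun k _ => hint _ (hA k),
      integral_finsetSum _ fun k _ => integrable_finsetSum _ fun l _ =>
        hint _ ((hA k).inter (hA l)),
      Finset.sum_congr rfl fun k _ => hval _ (hA k),
      Finset.sum_congr rfl fun k _ => (integral_finsetSum _ fun l _ =>
        hint _ ((hA k).inter (hA l))).trans
          (Finset.sum_congr rfl fun l _ => hval _ ((hA k).inter (hA l)))]
    simp
  -- Both sides are integrals; pointwise, with `H` for `F - r`, this is
  -- `(H - c * 1_B) ^ 2 ≥ 0` combined with `1_B ≤ 1`.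
  rw [← h1, ← h2]
  refine integral_mono ((hI1.const_mul _).sub (integrable_const _))
    ((hI2.sub (hI3.const_mul _)).add (integrable_const _)) fun x => ?_
  have hB01 : e B x = 0 ∨ e B x = 1 := by
    by_cases hx : x ∈ B <;> simp [e, hx]
  simp only [hmul, ← Finset.mul_sum, ← Finset.sum_mul]
  generalize ∑ k ∈ K, e (A k) x = F
  rcases hB01 with h | h <;> rw [h] <;>
    nlinarith [sq_nonneg (F - r), sq_nonneg (F - r - c), sq_nonneg c]

omit [MeasurableSpace X] in
lemma vadd_iInter (g : G) (A : ι → Set X) : g +ᵥ ⋂ j, A j = ⋂ j, g +ᵥ A j := by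
  ext x
  simp [Set.mem_vadd_set_iff_neg_vadd_mem]

/-- The diagonal form is a correlation form. -/
lemma isCorrelationForm_iInter [Countable ι] (μ : Measure X) [IsProbabilityMeasure μ]
    [MeasurableConstVAdd G X] [VAddInvariantMeasure G X μ] :
    IsCorrelationForm (ι := ι) G (fun A => μ.real (⋂ j, A j)) where
  mem_Icc A _ := ⟨measureReal_nonneg, measureReal_le_one⟩
  vadd_eq A _ g := by simp only [← vadd_iInter, measureReal_def, measure_vadd]
  sq_le K A B r hA hB := by
    simp only [Set.iInter_inter_distrib]
    exact sq_sum_measureReal_inter_le μ K r (fun k => .iInter (hA k)) (.iInter hB)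

lemma isIndepForm_iInter [Fintype ι] (μ : Measure X) [IsProbabilityMeasure μ] :
    IsIndepForm (ι := ι) μ 1 (fun A => μ.real (⋂ j, A j)) := by
  classical
  intro J hJ A hA huniv
  by_cases hne : ∃ i, i ∈ J
  · obtain ⟨i, hi⟩ := hne
    have hu : ∀ j, j ≠ i → A j = Set.univ := fun j hj => huniv j fun hjJ =>
      hj (Finset.card_le_one.1 hJ j hjJ i hi)
    rw [Finset.prod_eq_single i (fun j _ hj => by simp [hu j hj]) (by simp)]
    refine congrArg μ.real ?_
    refine (Set.iInter_subset A i).antisymm (Set.subset_iInter fun j => ?_)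
    by_cases hj : j = i
    · rw [hj]
    · simp [hu j hj]
  · push Not at hne
    simp [fun j => huniv j (hne j)]

lemma tendsto_cofinite_of_finite_ker {f : G →+ G} (h : Finite f.ker) :
    Tendsto f cofinite cofinite := by
  refine Tendsto.cofinite_of_finite_preimage_singleton fun y => ?_
  by_cases hy : ∃ x, f x = y
  · obtain ⟨x, rfl⟩ := hy
    refine ((Set.toFinite (f.ker : Set G)).image (x + ·)).subset fun z hz => ?_
    refine ⟨z - x, ?_, by simp⟩
    have hz : f z = f x := hz
    simp [AddMonoidHom.mem_ker, hz]
  · rw [Set.eq_empty_of_forall_notMem (s := f ⁻¹' {y}) fun z hz => hy ⟨z, hz⟩]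
    exact Set.finite_empty

/-! ### Twisting and limits of correlation forms -/

section Step

variable [Fintype ι] [DecidableEq ι] {μ : Measure X} [IsProbabilityMeasure μ]
  [MeasurableConstVAdd G X] [VAddInvariantMeasure G X μ]

/-- Twisting makes one more coordinate independent. By diagonal invariance, one coordinate `i`
may be assumed not to be twisted. The remaining coordinates are independent by assumption, so the
strong mixing property makes their twists asymptotically orthogonal, up to subtracting the mean, and
hence they converge weakly. -/
lemma tendsto_twist_of_isIndepForm (hmix : IsStronglyMixing G μ) {φ : ι → G →+ G}
    (hφ : ∀ i j, i ≠ j → Finite (φ j - φ i).ker) {Λ : (ι → Set X) → ℝ} {n : ℕ} (hn : 1 ≤ n)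
    (hΛ : IsCorrelationForm G Λ) (hind : IsIndepForm μ n Λ) {J : Finset ι} {i : ι}
    (hJ : (J.erase i).card ≤ n) {A : ι → Set X} (hA : ∀ j, MeasurableSet (A j))
    (huniv : ∀ j ∉ J, A j = Set.univ) :
    Tendsto (fun g => Λ (fun j => φ j g +ᵥ A j)) cofinite (𝓝 (∏ j, μ.real (A j))) := by
  set ψ : ι → G →+ G := fun j => φ j - φ i with hψ
  set B : ι → Set X := fun j => if j = i then A i else Set.univ with hB
  set A' : ι → Set X := fun j => if j = i then Set.univ else A j with hA'
  have hBm : ∀ j, MeasurableSet (B j) := fun j => by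
    by_cases h : j = i <;> simp [hB, h, hA]
  have hA'm : ∀ j, MeasurableSet (A' j) := fun j => by
    by_cases h : j = i <;> simp [hA', h, hA]
  have hA'u : ∀ j ∉ J.erase i, A' j = Set.univ := fun j hj => by
    by_cases h : j = i
    · simp [hA', h]
    · simpa [hA', h] using huniv j fun hjJ => hj (Finset.mem_erase.2 ⟨h, hjJ⟩)
  have hAg : ∀ g j, MeasurableSet (ψ j g +ᵥ A' j) := fun g j => (hA'm j).const_vadd _
  have hred : ∀ g, Λ (fun j => φ j g +ᵥ A j) = Λ (fun j => B j ∩ (ψ j g +ᵥ A' j)) := by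
    intro g
    rw [← hΛ.vadd_eq (fun j => B j ∩ (ψ j g +ᵥ A' j)) (fun j => (hBm j).inter (hAg g j)) (φ i g)]
    congr 1
    ext1 j
    by_cases h : j = i
    · subst h
      simp [hψ, hB, hA']
    · simp [hψ, hB, hA', h, vadd_vadd]
  set p : ℝ := ∏ j, μ.real (A' j) with hp
  set b : ℝ := ∏ j, μ.real (B j) with hb
  have hprod : ∏ j, μ.real (A j) = b * p := by
    rw [hp, hb, ← Finset.prod_mul_distrib]
    refine Finset.prod_congr rfl fun j _ => ?_
    by_cases h : j = i <;> simp [hB, hA', h]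
  have hΛB : Λ B = b := hind {i} (by simpa using hn) B hBm fun j hj => by
    simp [hB, show j ≠ i by simpa using hj]
  have hΛA : ∀ g, Λ (fun j => ψ j g +ᵥ A' j) = p := fun g => by
    rw [hind _ hJ _ (hAg g) fun j hj => by simp [hA'u j hj]]
    simp only [measureReal_def, measure_vadd, hp]
  have hΛAA : ∀ g h, Λ (fun j => (ψ j g +ᵥ A' j) ∩ (ψ j h +ᵥ A' j)) =
      ∏ j, μ.real ((ψ j g +ᵥ A' j) ∩ (ψ j h +ᵥ A' j)) := fun g h =>
    hind _ hJ _ (fun j => (hAg g j).inter (hAg h j)) fun j hj => by simp [hA'u j hj]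
  have hlim : ∀ h, Tendsto (fun g => ∏ j, μ.real ((ψ j g +ᵥ A' j) ∩ (ψ j h +ᵥ A' j))) cofinite
      (𝓝 (p * p)) := by
    intro h
    rw [hp, ← Finset.prod_mul_distrib]
    refine tendsto_finsetProd _ fun j _ => ?_
    by_cases hj : j = i
    · simpa [hA', hj] using tendsto_const_nhds
    · have := (hmix (ψ j h +ᵥ A' j) (A' j) (hAg h j) (hA'm j)).comp
        (tendsto_cofinite_of_finite_ker (hφ i j (Ne.symm hj)))
      simp only [measureReal_def, measure_vadd] at this ⊢
      simpa only [Function.comp_def, Set.inter_comm] using this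
  have hzero : Tendsto (fun g => Λ (fun j => B j ∩ (ψ j g +ᵥ A' j)) - b * p) cofinite (𝓝 0) := by
    refine tendsto_zero_of_sq_sum_le (C := 1)
      (c := fun g h => Λ (fun j => (ψ j g +ᵥ A' j) ∩ (ψ j h +ᵥ A' j)) - p * p) ?_ ?_ ?_ ?_
    · intro K
      have := hΛ.sq_le K (fun g j => ψ j g +ᵥ A' j) B (K.card * p) hAg hBm
      simp only [hΛA, hΛB, Finset.sum_const, nsmul_eq_mul] at this
      simp only [Finset.sum_sub_distrib, Finset.sum_const, nsmul_eq_mul]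
      calc _ = _ := by ring
        _ ≤ _ := this
        _ = _ := by ring
    · intro g h
      simp only [Set.inter_comm]
    · intro g
      have := (hΛ.mem_Icc _ fun j => (hAg g j).inter (hAg g j)).2
      linarith [mul_self_nonneg p]
    · intro h
      simp only [hΛAA]
      simpa using (hlim h).sub_const (p * p)
  simp only [hred, hprod]
  simpa using hzero.add_const (b * p)

/-- Passing to the limit along `U` in twists of a form whose coordinates are `n`-wise independent
gives a form whose coordinates are `(n + 1)`-wise independent. -/
lemma exists_limit_form (hmix : IsStronglyMixing G μ) {φ : ι → G →+ G}
    (hφ : ∀ i j, i ≠ j → Finite (φ j - φ i).ker) {Λ : (ι → Set X) → ℝ} {n : ℕ} (hn : 1 ≤ n)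
    (hΛ : IsCorrelationForm G Λ) (hind : IsIndepForm μ n Λ) (hne : Nonempty ι)
    (U : Ultrafilter ℕ) {u : ℕ → G} (hu : Tendsto u U cofinite) :
    ∃ Λ' : (ι → Set X) → ℝ, IsCorrelationForm G Λ' ∧ IsIndepForm μ (n + 1) Λ' ∧
      ∀ A, (∀ j, MeasurableSet (A j)) →
        Tendsto (fun k => Λ (fun j => φ j (u k) +ᵥ A j)) U (𝓝 (Λ' A)) := by
  have hex : ∀ A : ι → Set X, ∃ x : ℝ, (∀ j, MeasurableSet (A j)) →
      x ∈ Set.Icc (0 : ℝ) 1 ∧ Tendsto (fun k => Λ (fun j => φ j (u k) +ᵥ A j)) U (𝓝 x) := by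
    intro A
    by_cases hA : ∀ j, MeasurableSet (A j)
    · obtain ⟨x, hx, hlim⟩ := isCompact_Icc.ultrafilter_le_nhds
        (U.map fun k => Λ (fun j => φ j (u k) +ᵥ A j))
        (le_principal_iff.2 (Filter.mem_map.2 (Filter.univ_mem' fun k =>
          hΛ.mem_Icc _ fun j => (hA j).const_vadd _)))
      exact ⟨x, fun _ => ⟨hx, hlim⟩⟩
    · exact ⟨0, fun h => (hA h).elim⟩
  choose Λ' hΛ' using hex
  refine ⟨Λ', ⟨fun A hA => (hΛ' A hA).1, fun A hA g => ?_, fun K A B r hA hB => ?_⟩, ?_,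
    fun A hA => (hΛ' A hA).2⟩
  · refine tendsto_nhds_unique (hΛ' _ fun j => (hA j).const_vadd g).2
      ((hΛ' A hA).2.congr fun k => ?_)
    rw [← hΛ.vadd_eq _ (fun j => (hA j).const_vadd _) g]
    simp only [vadd_vadd, add_comm g]
  · have hlim1 : ∀ k, Tendsto (fun l => Λ (fun j => (φ j (u l) +ᵥ B j) ∩ (φ j (u l) +ᵥ A k j))) U
        (𝓝 (Λ' fun j => B j ∩ A k j)) := fun k => by
      simpa only [Set.vadd_set_inter] using (hΛ' _ fun j => (hB j).inter (hA k j)).2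
    have hlim2 : ∀ k k', Tendsto (fun l => Λ (fun j => (φ j (u l) +ᵥ A k j) ∩
        (φ j (u l) +ᵥ A k' j))) U (𝓝 (Λ' fun j => A k j ∩ A k' j)) := fun k k' => by
      simpa only [Set.vadd_set_inter] using (hΛ' _ fun j => (hA k j).inter (hA k' j)).2
    refine le_of_tendsto_of_tendsto'
      (((tendsto_finsetSum K fun k _ => hlim1 k).sub ((hΛ' B hB).2.const_mul r)).pow 2)
      (((tendsto_finsetSum K fun k _ => tendsto_finsetSum K fun k' _ => hlim2 k k').sub
        ((tendsto_finsetSum K fun k _ => (hΛ' _ (hA k)).2).const_mul (2 * r))).add_const (r ^ 2))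
      fun l => ?_
    exact hΛ.sq_le K (fun k j => φ j (u l) +ᵥ A k j) (fun j => φ j (u l) +ᵥ B j) r
      (fun k j => (hA k j).const_vadd _) fun j => (hB j).const_vadd _
  · intro J hJ A hA huniv
    obtain ⟨i, hi⟩ : ∃ i, (J.erase i).card ≤ n := by
      rcases J.eq_empty_or_nonempty with rfl | ⟨i, hi⟩
      · exact ⟨hne.some, by simp⟩
      · exact ⟨i, by rw [Finset.card_erase_of_mem hi]; omega⟩
    exact tendsto_nhds_unique (hΛ' A hA).2
      ((tendsto_twist_of_isIndepForm hmix hφ hn hΛ hind hi hA huniv).comp hu)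

/-- Iterating the passage to the limit along the `t` coordinates of a non-degenerated sequence, the
last coordinate first, starting from the diagonal form. The resulting form is approximated by
correlations at sums `g_{k₁,1} + ⋯ + g_{k_t,t}` with `k₁ < ⋯ < k_t` arbitrarily large. -/
lemma exists_iterated_limit_form (hmix : IsStronglyMixing G μ) {φ : ι → G →+ G}
    (hφ : ∀ i j, i ≠ j → Finite (φ j - φ i).ker) (hne : Nonempty ι) (t : ℕ)
    (g : ℕ → Fin t → G) (hg : NonDegenerated g) :
    ∃ Λ : (ι → Set X) → ℝ, IsCorrelationForm G Λ ∧ IsIndepForm μ (t + 1) Λ ∧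
      ∀ A, (∀ j, MeasurableSet (A j)) → ∀ ε : ℝ, 0 < ε → ∀ N : ℕ,
        ∃ k : Fin t → ℕ, StrictMono k ∧ (∀ i, N < k i) ∧
          |μ.real (⋂ j, φ j (∑ i, g (k i) i) +ᵥ A j) - Λ A| < ε := by
  induction t with
  | zero =>
    refine ⟨_, isCorrelationForm_iInter μ, isIndepForm_iInter μ, fun A _ ε hε N =>
      ⟨Fin.elim0, Subsingleton.strictMono _, fun i => i.elim0, by simpa using hε⟩⟩
  | succ t ih =>
    obtain ⟨Λ, hΛ, hind, happ⟩ := ih (fun k i => g k i.succ) fun i => hg i.succ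
    let U : Ultrafilter ℕ := Ultrafilter.of atTop
    have hU : (U : Filter ℕ) ≤ atTop := Ultrafilter.of_le _
    obtain ⟨Λ', hΛ', hind', hlim⟩ := exists_limit_form hmix hφ (by omega) hΛ hind hne U
      ((hg 0).mono_left hU)
    refine ⟨Λ', hΛ', hind', fun A hA ε hε N => ?_⟩
    obtain ⟨k₀, hk₀, hN⟩ := ((Metric.tendsto_nhds.1 (hlim A hA) (ε / 2) (by positivity)).and
      (hU (eventually_gt_atTop N))).exists
    obtain ⟨k, hk, hlt, hkε⟩ := happ (fun j => φ j (g k₀ 0) +ᵥ A j)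
      (fun j => (hA j).const_vadd _) (ε / 2) (by positivity) k₀
    refine ⟨Fin.cons k₀ k, Fin.strictMono_cons.2 ⟨hlt, hk⟩, ?_, ?_⟩
    · intro i
      refine Fin.cases ?_ (fun i => ?_) i
      · simpa using hN
      · simpa using lt_trans hN (hlt i)
    · rw [Real.dist_eq] at hk₀
      simp only [vadd_vadd, ← map_add] at hkε
      rw [Fin.sum_univ_succ]
      simp only [Fin.cons_zero, Fin.cons_succ]
      rw [add_comm (g k₀ 0)]
      calc _ ≤ _ := abs_sub_le _ _ _
        _ < ε / 2 + ε / 2 := add_lt_add hkε hk₀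
        _ = ε := by ring

end Step

section Main

variable {G X : Type*} [AddCommGroup G] [AddAction G X] [MeasurableSpace X]

/-! ### Multicorrelations and sums over increasing indices -/

lemma alphaSum_eq_of_strictMono {m : ℕ} (g : ℕ → Fin m → G) (α : NSubsets m) {k : Fin m → ℕ}
    (hk : StrictMono k) (hmem : ∀ i, k i ∈ α.1) : alphaSum g α = ∑ i, g (k i) i := by
  rw [alphaSum, ← Finset.orderEmbOfFin_unique α.2 hmem hk]

omit [AddCommGroup G] in
lemma NonDegenerated.comp_strictMono {m : ℕ} {g : ℕ → Fin m → G} (hg : NonDegenerated g)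
    {e : ℕ → ℕ} (he : StrictMono e) : NonDegenerated fun k => g (e k) :=
  fun j => (hg j).comp he.tendsto_atTop

/-- The homomorphisms `0, φ₁, …, φ_ℓ`, which put the set `A₀` on the same footing as the
others. -/
def consZero {ℓ : ℕ} (φ : Fin ℓ → G →+ G) : Fin (ℓ + 1) → G →+ G := Fin.cons 0 φ

lemma correlation_eq (μ : Measure X) {ℓ : ℕ} (φ : Fin ℓ → G →+ G) (A : Fin (ℓ + 1) → Set X)
    (g : G) : correlation μ φ A g = μ.real (⋂ j, consZero φ j g +ᵥ A j) := by
  rw [correlation]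
  congr 1
  ext x
  simp [consZero, Fin.forall_fin_succ]

lemma finite_ker_consZero_sub {ℓ : ℕ} {φ : Fin ℓ → G →+ G} (hker : ∀ j, Finite (φ j).ker)
    (hker_sub : ∀ i j, i ≠ j → Finite (φ j - φ i).ker) (i j : Fin (ℓ + 1)) (hij : i ≠ j) :
    Finite (consZero φ j - consZero φ i).ker := by
  induction i using Fin.cases with
  | zero =>
    induction j using Fin.cases with
    | zero => exact absurd rfl hij
    | succ j => simpa [consZero] using hker j
  | succ i =>
    induction j using Fin.cases with
    | zero =>
      have : (consZero φ 0 - consZero φ i.succ).ker = (φ i).ker := by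
        ext x
        simp [consZero, AddMonoidHom.mem_ker]
      rw [this]
      exact hker i
    | succ j => simpa [consZero] using hker_sub i j fun h => hij (congrArg Fin.succ h)

/-- The last of the iterated limit forms has all its `ℓ + 1` coordinates independent, so
correlations close to the product of the measures occur in every `Σ_ℓ` set. -/
theorem hasDiagonalSigmaStar_of_isStronglyMixing {μ : Measure X} [IsProbabilityMeasure μ]
    [MeasurableConstVAdd G X] [VAddInvariantMeasure G X μ] {ℓ : ℕ} {φ : Fin ℓ → G →+ G}
    (hker : ∀ j, Finite (φ j).ker) (hker_sub : ∀ i j, i ≠ j → Finite (φ j - φ i).ker)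
    (hmix : IsStronglyMixing G μ) : HasDiagonalSigmaStar μ φ := by
  rintro A hA ε hε _ ⟨g, hg, rfl⟩
  obtain ⟨Λ, -, hind, happ⟩ := exists_iterated_limit_form hmix
    (finite_ker_consZero_sub hker hker_sub) ⟨0⟩ ℓ g hg
  obtain ⟨k, hk, -, hkε⟩ := happ A hA ε hε 0
  let α : NSubsets ℓ := ⟨Finset.univ.image k, by
    simp [Finset.card_image_of_injective _ hk.injective]⟩
  refine ⟨alphaSum g α, ?_, ⟨α, rfl⟩⟩
  rw [returnSet, Set.mem_ofPred_eq, correlation_eq,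
    alphaSum_eq_of_strictMono g α hk fun i => Finset.mem_image_of_mem k (Finset.mem_univ i)]
  rwa [hind Finset.univ (by simp) A hA fun j hj => absurd (Finset.mem_univ j) hj] at hkε

/-! ### From `R`-limits to `Σ_ℓ^*` sets -/

theorem HasDiagonalRLimits.hasDiagonalSigmaStar {μ : Measure X} {ℓ : ℕ} {φ : Fin ℓ → G →+ G}
    (h : HasDiagonalRLimits μ φ) : HasDiagonalSigmaStar μ φ := by
  rintro A hA ε hε _ ⟨g, hg, rfl⟩
  obtain ⟨S, hS, hlim⟩ := h g hg
  obtain ⟨α₀, hα₀⟩ := hlim A hA ε hε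
  obtain ⟨α, hαS, hα⟩ := (hS.sdiff (Set.finite_Iic (α₀.1.sup id))).exists_subset_card_eq ℓ
  refine ⟨alphaSum g ⟨α, hα⟩, hα₀ ⟨α, hα⟩ (hαS.trans Set.sdiff_subset) fun i hi k hk => ?_,
    ⟨_, rfl⟩⟩
  exact (Finset.le_sup (f := id) hi).trans_lt (not_le.1 (hαS hk).2)

/-! ### From `Σ_ℓ^*` sets to `R`-limits -/

/-- A subsequence of a non-degenerated sequence is non-degenerated, so the indices at which the
correlation is close to the product may be taken in any given infinite set. -/
lemma HasDiagonalSigmaStar.exists_subset {μ : Measure X} {ℓ : ℕ} {φ : Fin ℓ → G →+ G}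
    (h : HasDiagonalSigmaStar μ φ) {g : ℕ → Fin ℓ → G} (hg : NonDegenerated g)
    {A : Fin (ℓ + 1) → Set X} (hA : ∀ j, MeasurableSet (A j)) {ε : ℝ} (hε : 0 < ε) {T : Set ℕ}
    (hT : T.Infinite) :
    ∃ α : NSubsets ℓ, (α.1 : Set ℕ) ⊆ T ∧
      |correlation μ φ A (alphaSum g α) - ∏ j, μ.real (A j)| < ε := by
  obtain ⟨e, he, heT⟩ := extraction_of_frequently_atTop (Nat.frequently_atTop_iff_infinite.2 hT)
  obtain ⟨_, hmem, β, rfl⟩ := h A hA ε hε _ ⟨_, hg.comp_strictMono he, rfl⟩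
  let α : NSubsets ℓ := ⟨β.1.image e, by rw [Finset.card_image_of_injective _ he.injective, β.2]⟩
  refine ⟨α, fun x hx => ?_, ?_⟩
  · obtain ⟨k, -, rfl⟩ := Finset.mem_image.1 hx
    exact heT k
  · rw [alphaSum_eq_of_strictMono g α (he.comp (β.1.orderEmbOfFin β.2).strictMono) fun i =>
      Finset.mem_image_of_mem e (Finset.orderEmbOfFin_mem β.1 β.2 i)]
    exact hmem

/-- By Ramsey's theorem, an infinite set of indices can be thinned out so that all the correlations
are close to the product. -/
lemma HasDiagonalSigmaStar.exists_infinite {μ : Measure X} {ℓ : ℕ} {φ : Fin ℓ → G →+ G}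
    (h : HasDiagonalSigmaStar μ φ) {g : ℕ → Fin ℓ → G} (hg : NonDegenerated g)
    {A : Fin (ℓ + 1) → Set X} (hA : ∀ j, MeasurableSet (A j)) {ε : ℝ} (hε : 0 < ε) {T : Set ℕ}
    (hT : T.Infinite) :
    ∃ S ⊆ T, S.Infinite ∧ ∀ α : NSubsets ℓ, (α.1 : Set ℕ) ⊆ S →
      |correlation μ φ A (alphaSum g α) - ∏ j, μ.real (A j)| < ε := by
  obtain ⟨S, hST, hS, hP | hP⟩ := exists_infinite_homogeneous ℓ (fun α => ∃ hα : α.card = ℓ,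
    |correlation μ φ A (alphaSum g ⟨α, hα⟩) - ∏ j, μ.real (A j)| < ε) hT
  · exact ⟨S, hST, hS, fun α hα => (hP α.1 hα α.2).2⟩
  · obtain ⟨α, hαS, hα⟩ := h.exists_subset hg hA hε hS
    exact absurd ⟨α.2, hα⟩ (hP α.1 hαS α.2)

open scoped symmDiff in
lemma abs_measureReal_iInter_sub_le {ι : Type*} [Fintype ι] (μ : Measure X) [IsFiniteMeasure μ]
    {A B : ι → Set X} (hA : ∀ j, MeasurableSet (A j)) (hB : ∀ j, MeasurableSet (B j)) :
    |μ.real (⋂ j, A j) - μ.real (⋂ j, B j)| ≤ ∑ j, μ.real (A j ∆ B j) := by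
  refine (abs_measureReal_sub_le_measureReal_symmDiff
    (MeasurableSet.iInter hA).nullMeasurableSet (MeasurableSet.iInter hB).nullMeasurableSet).trans
    ((measureReal_mono ?_).trans (measureReal_iUnion_fintype_le fun j => A j ∆ B j))
  rintro x (⟨hx, hx'⟩ | ⟨hx, hx'⟩)
  · obtain ⟨j, hj⟩ := by simpa using hx'
    exact Set.mem_iUnion.2 ⟨j, .inl ⟨Set.mem_iInter.1 hx j, hj⟩⟩
  · obtain ⟨j, hj⟩ := by simpa using hx'
    exact Set.mem_iUnion.2 ⟨j, .inr ⟨Set.mem_iInter.1 hx j, hj⟩⟩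

lemma abs_prod_sub_prod_le {ι : Type*} (s : Finset ι) {a b : ι → ℝ}
    (ha : ∀ j, a j ∈ Set.Icc (0 : ℝ) 1) (hb : ∀ j, b j ∈ Set.Icc (0 : ℝ) 1) :
    |∏ j ∈ s, a j - ∏ j ∈ s, b j| ≤ ∑ j ∈ s, |a j - b j| := by
  classical
  induction s using Finset.induction_on with
  | empty => simp
  | insert i s hi ih =>
    rw [Finset.prod_insert hi, Finset.prod_insert hi, Finset.sum_insert hi]
    have h1 : |∏ j ∈ s, a j| ≤ 1 := by
      rw [abs_of_nonneg (Finset.prod_nonneg fun j _ => (ha j).1)]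
      exact Finset.prod_le_one (fun j _ => (ha j).1) fun j _ => (ha j).2
    calc |a i * ∏ j ∈ s, a j - b i * ∏ j ∈ s, b j|
        = |(a i - b i) * ∏ j ∈ s, a j + b i * (∏ j ∈ s, a j - ∏ j ∈ s, b j)| := by ring_nf
      _ ≤ |a i - b i| * |∏ j ∈ s, a j| + |b i| * |∏ j ∈ s, a j - ∏ j ∈ s, b j| := by
        rw [← abs_mul, ← abs_mul]
        exact abs_add_le _ _
      _ ≤ |a i - b i| * 1 + 1 * ∑ j ∈ s, |a j - b j| := by
        gcongr
        rw [abs_of_nonneg (hb i).1]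
        exact (hb i).2
      _ = _ := by ring

open scoped symmDiff in
/-- The discrepancy between the correlation and the product of the measures depends on the sets in
a Lipschitz way, uniformly in `g`. -/
lemma abs_correlation_sub_prod_le {μ : Measure X} [IsProbabilityMeasure μ]
    [MeasurableConstVAdd G X] [VAddInvariantMeasure G X μ] {ℓ : ℕ} (φ : Fin ℓ → G →+ G)
    {A B : Fin (ℓ + 1) → Set X} (hA : ∀ j, MeasurableSet (A j)) (hB : ∀ j, MeasurableSet (B j))
    (g : G) :
    |correlation μ φ A g - ∏ j, μ.real (A j)| ≤
      |correlation μ φ B g - ∏ j, μ.real (B j)| + 2 * ∑ j, μ.real (A j ∆ B j) := by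
  have h1 : |correlation μ φ A g - correlation μ φ B g| ≤ ∑ j, μ.real (A j ∆ B j) := by
    rw [correlation_eq, correlation_eq]
    refine (abs_measureReal_iInter_sub_le μ (fun j => (hA j).const_vadd _)
      fun j => (hB j).const_vadd _).trans_eq (Finset.sum_congr rfl fun j _ => ?_)
    rw [← Set.vadd_set_symmDiff, measureReal_def, measure_vadd, measureReal_def]
  have h2 : |∏ j, μ.real (B j) - ∏ j, μ.real (A j)| ≤ ∑ j, μ.real (A j ∆ B j) := by
    rw [abs_sub_comm]
    exact (abs_prod_sub_prod_le _ (fun j => ⟨measureReal_nonneg, measureReal_le_one⟩)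
      fun j => ⟨measureReal_nonneg, measureReal_le_one⟩).trans (Finset.sum_le_sum fun j _ =>
        abs_measureReal_sub_le_measureReal_symmDiff (hA j).nullMeasurableSet
          (hB j).nullMeasurableSet)
  have h3 := abs_add_three (correlation μ φ A g - correlation μ φ B g)
    (correlation μ φ B g - ∏ j, μ.real (B j)) (∏ j, μ.real (B j) - ∏ j, μ.real (A j))
  rw [show correlation μ φ A g - correlation μ φ B g +
    (correlation μ φ B g - ∏ j, μ.real (B j)) + (∏ j, μ.real (B j) - ∏ j, μ.real (A j)) =
    correlation μ φ A g - ∏ j, μ.real (A j) by ring] at h3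
  linarith

/-- The Ramsey argument is diagonalized over the tuples from a countable measure-dense family and
the tolerances `1 / (q + 1)`; the Lipschitz estimate then yields all tuples of measurable sets. -/
theorem HasDiagonalSigmaStar.hasDiagonalRLimits {μ : Measure X} [IsProbabilityMeasure μ]
    [IsSeparable μ] [MeasurableConstVAdd G X] [VAddInvariantMeasure G X μ] {ℓ : ℕ} (hℓ : 1 ≤ ℓ)
    {φ : Fin ℓ → G →+ G} (h : HasDiagonalSigmaStar μ φ) : HasDiagonalRLimits μ φ := by
  intro g hg
  obtain ⟨𝒜, hcount, hdense⟩ := exists_countable_measureDense (μ := μ)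
  have := hcount.to_subtype
  have : Nonempty 𝒜 := hdense.nonempty.to_subtype
  obtain ⟨f, hf⟩ := exists_surjective_nat ((Fin (ℓ + 1) → 𝒜) × ℕ)
  obtain ⟨S, hS, hdiag⟩ := exists_infinite_diagonal
    (R := fun n T => ∀ α : NSubsets ℓ, (α.1 : Set ℕ) ⊆ T →
      |correlation μ φ (fun j => ((f n).1 j).1) (alphaSum g α) - ∏ j, μ.real ((f n).1 j).1| <
        1 / ((f n).2 + 1 : ℝ))
    fun n T hT => h.exists_infinite hg (fun j => hdense.measurable _ ((f n).1 j).2)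
      Nat.one_div_pos_of_nat hT
  refine ⟨S, hS, fun A hA ε hε => ?_⟩
  have hδ : 0 < ε / (4 * (ℓ + 1 : ℝ)) := by positivity
  choose B hB hAB using fun j => hdense.approx (A j) (hA j) (measure_ne_top μ _) _ hδ
  obtain ⟨q, hq⟩ := exists_nat_one_div_lt (half_pos hε)
  obtain ⟨n, hn⟩ := hf (fun j => ⟨B j, hB j⟩, q)
  obtain ⟨N, T, hT, hST⟩ := hdiag n
  simp only [hn] at hT
  -- `α₀` is nonempty because `1 ≤ ℓ`, so it forces all the elements of `α` to exceed `N`.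
  refine ⟨⟨Finset.Ico N (N + ℓ), by simp⟩, fun α hα hlt => ?_⟩
  have hclose := hT α fun k hk => hST ⟨hα hk, hlt N (Finset.mem_Ico.2 ⟨le_rfl, by omega⟩) k hk⟩
  have hsum : ∑ j, μ.real (symmDiff (A j) (B j)) ≤ ε / 4 := by
    calc ∑ j, μ.real (symmDiff (A j) (B j)) ≤ ∑ _j : Fin (ℓ + 1), ε / (4 * (ℓ + 1 : ℝ)) :=
          Finset.sum_le_sum fun j _ => ENNReal.toReal_le_of_le_ofReal hδ.le (hAB j).le
      _ = ε / 4 := by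
        simp
        field_simp
  have := abs_correlation_sub_prod_le (μ := μ) φ hA (fun j => hdense.measurable _ (hB j))
    (alphaSum g α)
  rw [Real.dist_eq]
  linarith

end Main

end StrongMixing

theorem theorem4 {G X : Type*} [AddCommGroup G] [Countable G]
    [MeasurableSpace X] (μ : Measure X) [IsProbabilityMeasure μ] [IsSeparable μ]
    [AddAction G X] [MeasurableConstVAdd G X] [VAddInvariantMeasure G X μ]
    (ℓ : ℕ) (hℓ : 1 ≤ ℓ) (φ : Fin ℓ → G →+ G)
    (hker : ∀ j, Finite (φ j).ker)
    (hker_sub : ∀ i j, i ≠ j → Finite (φ j - φ i).ker) :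
    (StrongMixing.IsStronglyMixing G μ →
      StrongMixing.HasDiagonalRLimits μ φ ∧ StrongMixing.HasDiagonalSigmaStar μ φ) ∧
    (StrongMixing.HasDiagonalRLimits μ φ ↔ StrongMixing.HasDiagonalSigmaStar μ φ) := by
  refine ⟨fun hmix => ?_, fun h => h.hasDiagonalSigmaStar, fun h => h.hasDiagonalRLimits hℓ⟩
  have h := StrongMixing.hasDiagonalSigmaStar_of_isStronglyMixing hker hker_sub hmix
  exact ⟨h.hasDiagonalRLimits hℓ, h⟩
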